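/- Let $\mathcal X,\mathcal Y$ be measurable spaces whose points are measurable, let $E$ be a real vector space, $\mathcal F$ a convex set of functions $f:\mathcal X\to E$, and $\ell:E\times\mathcal Y\to\mathbb R$ a loss such that $f\mapsto \ell(f(x),y)$ is convex on $\mathcal F$ for every $(x,y)$. Let $\mathfrak D_t$ and $\mathfrak B_t^1,\dots,\mathfrak B_t^t$ be probability measures on $\mathcal X\times\mathcal Y$ (the current task and the buffer distributions), put $\mathfrak B=\sum_{k}\mathfrak B_t^k$, and suppose that $\ell(f(x),y)$ is $\mathfrak D_t$-integrable for every $f\in\mathcal F$. For $e:\mathcal X\times\mathcal Y\to\mathbb R$ let $$P_t^\star(e)=\inf\bigl\{\mathbb E_{\mathfrak D_t}[\ell(f(x),y)] : f\in\mathcal F,\ \ell(f(x),y)\le e(x,y)\ \ \mathfrak B_t^k\text{-a.e. for all }k=1,\dots,t\bigr\}\in[-\infty,+\infty].$$ Fix $\epsilon:\mathcal X\times\mathcal Y\to\mathbb R$ with $P_t^\star(\epsilon)>-\infty$, and assume strict feasibility: there are $f_0\in\mathcal F$ and $c>0$ with $\ell(f_0(x),y)\le\epsilon(x,y)-c$,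 $\mathfrak B_t^k$-a.e. for all $k$. The multipliers are the continuous linear functionals $\Lambda\ge 0$ on $L^\infty(\mathfrak B)$, the Lagrangian is $L(f,\Lambda)=\mathbb E_{\mathfrak D_t}[\ell(f(x),y)]+\langle\Lambda,\ \ell(f(x),y)-\epsilon(x,y)\rangle$, where $\langle\Lambda,s\rangle=\inf\{\Lambda(h):h\in L^\infty(\mathfrak B),\ s\le h\ \mathfrak B\text{-a.e.}\}$ (which is $\Lambda(s)$ when $s\in L^\infty(\mathfrak B)$), and the optimal dual variables are the $\Lambda\geq 0$ that maximize $\inf_{f\in\mathcal F}L(f,\Lambda)$. The Fréchet subdifferential of an extended-real-valued function $\varphi$ on a real normed space, at a point $u$ where $\varphi$ is finite, is the set of continuous linear $\xi$ with $\liminf_{v\to u}\,[\varphi(v)-\varphi(u)-\xi(v-u)]/\|v-u\|\ge 0$. Then an optimal dual variable exists, and every optimal dual variable $\Lambda^\star_t$ satisfies: 1. $-\Lambda_t^\star$ belongs to the Fréchet subdifferential at $h=0$ of $L^\infty(\mathfrak B)\ni h\mapsto P_t^\star(\epsilon+h)$. 2. For every sample $(x,y)$, $-\Lambda^\star_t(\mathbf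 1_{\{(x,y)\}})$ belongs to the Fréchet subdifferential, at $r=\epsilon(x,y)$, of the function $r\mapsto P_t^\star(\epsilon^{(x,y),r})$, where $\epsilon^{(x,y),r}$ is $\epsilon$ with its value at $(x,y)$ replaced by $r$. 3. If $\Lambda_t^\star$ is given by an integrable function $\lambda_t^\star(x,y)$, that is $\Lambda_t^\star(h)=\int\lambda_t^\star h\,d\mathfrak B$ for all $h\in L^\infty(\mathfrak B)$, then for every sample $(x,y)$ with $m=\mathfrak B(\{(x,y)\})>0$, $-\lambda_t^\star(x,y)$ belongs to the Fréchet subdifferential at $s=0$ of $s\mapsto P_t^\star(\epsilon^{(x,y),\,\epsilon(x,y)+s/m})$ (the tolerance of the sample is perturbed, measured per unit of its buffer mass). -/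

import Mathlib

open MeasureTheory Filter Topology
open scoped ENNReal

noncomputable section

/-- The Fréchet subdifferential of an extended-real-valued function `φ` on a real normed space at a
point `x` where `φ` is finite: all continuous linear `ξ` with
`liminf_{v → x} (φ v - φ x - ξ (v - x)) / ‖v - x‖ ≥ 0`. It is empty where `φ` is infinite. -/
def frechetSubdiff {V : Type*} [NormedAddCommGroup V] [NormedSpace ℝ V]
    (φ : V → EReal) (x : V) : Set (V →L[ℝ] ℝ) :=
  {ξ | φ x ≠ ⊥ ∧ φ x ≠ ⊤ ∧
    ∀ η : ℝ, 0 < η →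
      ∀ᶠ v in 𝓝 x, φ x + ((ξ (v - x) - η * ‖v - x‖ : ℝ) : EReal) ≤ φ v}

namespace SampleLevel

variable {X Y E : Type*} [MeasurableSpace X] [MeasurableSpace Y]

/-- The expected loss `𝔼_D [ℓ(f(x), y)]`. -/
def risk (loss : E → Y → ℝ) (D : Measure (X × Y)) (f : X → E) : ℝ :=
  ∫ z, loss (f z.1) z.2 ∂D

/-- The predictors of the class `F` with `ℓ(f(x), y) ≤ e(x, y)`, `B k`-almost everywhere, for
every `k`. -/
def feasible {t : ℕ} (F : Set (X → E)) (loss : E → Y → ℝ) (B : Fin t → Measure (X × Y))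
    (e : X × Y → ℝ) : Set (X → E) :=
  {f | f ∈ F ∧ ∀ k, ∀ᵐ z ∂(B k), loss (f z.1) z.2 ≤ e z}

/-- The optimal value `P⋆(e)` of the problem with sample-level tolerances `e`, as a function of
the tolerances (`+∞` if the problem is infeasible). -/
def optValue {t : ℕ} (F : Set (X → E)) (loss : E → Y → ℝ) (D : Measure (X × Y))
    (B : Fin t → Measure (X × Y)) (e : X × Y → ℝ) : EReal :=
  ⨅ f ∈ feasible F loss B e, (risk loss D f : EReal)

/-- The total buffer measure `∑ k, B k`. A property holds almost everywhere for it if and only if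
it holds `B k`-almost everywhere for every `k`. -/
def bufferMeasure {t : ℕ} (B : Fin t → Measure (X × Y)) : Measure (X × Y) :=
  ∑ k, B k

instance {t : ℕ} (B : Fin t → Measure (X × Y)) [∀ k, IsFiniteMeasure (B k)] :
    IsFiniteMeasure (bufferMeasure B) := by
  unfold bufferMeasure; infer_instance

/-- The space of (bounded) perturbations of the tolerance function. -/
abbrev Perturbation {t : ℕ} (B : Fin t → Measure (X × Y)) : Type _ :=
  Lp ℝ ∞ (bufferMeasure B)

/-- Multipliers are the continuous linear functionals on the space of perturbations. Integrable
functions `w` give the multipliers `h ↦ ∑ k, ∫ w h d(B k)`. -/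
abbrev Multiplier {t : ℕ} (B : Fin t → Measure (X × Y)) : Type _ :=
  Perturbation B →L[ℝ] ℝ

/-- Nonnegative multipliers. -/
def Multiplier.IsNonneg {t : ℕ} {B : Fin t → Measure (X × Y)} (Λ : Multiplier B) : Prop :=
  ∀ h : Perturbation B, 0 ≤ h → 0 ≤ Λ h

/-- The value `⟨Λ, s⟩` of a nonnegative multiplier at a constraint residual `s = ℓ(f(x), y) - ε`,
which need not be essentially bounded: the infimum of `Λ h` over all essentially bounded `h`
with `s ≤ h` almost everywhere. -/
def pairing {t : ℕ} {B : Fin t → Measure (X × Y)} (Λ : Multiplier B) (s : X × Y → ℝ) : EReal :=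
  ⨅ h ∈ {h : Perturbation B | ∀ᵐ z ∂(bufferMeasure B), s z ≤ h z}, (Λ h : EReal)

/-- On essentially bounded residuals the pairing is just evaluation. -/
theorem pairing_coe {t : ℕ} {B : Fin t → Measure (X × Y)} {Λ : Multiplier B}
    (hΛ : Λ.IsNonneg) (h : Perturbation B) : pairing Λ h = (Λ h : EReal) := by
  apply le_antisymm
  · have hh : h ∈ {h' : Perturbation B | ∀ᵐ z ∂(bufferMeasure B), h z ≤ h' z} := by
      rw [Set.mem_ofPred_eq]
      exact Eventually.of_forall fun z => le_refl (h z)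
    exact iInf₂_le h hh
  · refine le_iInf₂ fun h' hh' => EReal.coe_le_coe_iff.2 ?_
    have h1 : h ≤ h' := (Lp.coeFn_le h h').1 hh'
    have h2 := hΛ (h' - h) (sub_nonneg.2 h1)
    rw [map_sub] at h2
    linarith

/-- The Lagrangian `L(f, Λ) = 𝔼_D [ℓ(f(x), y)] + ⟨Λ, ℓ(f(x), y) - ε(x, y)⟩`. -/
def lagrangian {t : ℕ} (loss : E → Y → ℝ) (D : Measure (X × Y)) {B : Fin t → Measure (X × Y)}
    (ε : X × Y → ℝ) (f : X → E) (Λ : Multiplier B) : EReal :=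
  (risk loss D f : EReal) + pairing Λ (fun z => loss (f z.1) z.2 - ε z)

/-- The dual function `g(Λ) = inf_{f ∈ F} L(f, Λ)`. -/
def dualFunction {t : ℕ} (F : Set (X → E)) (loss : E → Y → ℝ) (D : Measure (X × Y))
    {B : Fin t → Measure (X × Y)} (ε : X × Y → ℝ) (Λ : Multiplier B) : EReal :=
  ⨅ f ∈ F, lagrangian loss D ε f Λ

/-- Optimal dual variables: the maximizers of the dual function over the nonnegative
multipliers. -/
def IsOptimalDual {t : ℕ} (F : Set (X → E)) (loss : E → Y → ℝ) (D : Measure (X × Y))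
    {B : Fin t → Measure (X × Y)} (ε : X × Y → ℝ) (Λ : Multiplier B) : Prop :=
  Λ.IsNonneg ∧ ∀ Λ' : Multiplier B, Λ'.IsNonneg →
    dualFunction F loss D ε Λ' ≤ dualFunction F loss D ε Λ

/-- The multiplier `Λ` is given by the integrable function `w`: `Λ h = ∫ w h`. -/
def HasDensity {t : ℕ} {B : Fin t → Measure (X × Y)} (Λ : Multiplier B) (w : X × Y → ℝ) : Prop :=
  Integrable w (bufferMeasure B) ∧
    ∀ h : Perturbation B, Λ h = ∫ z, w z * h z ∂(bufferMeasure B)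

/-- The perturbation equal to `1` at the single sample `z` and to `0` elsewhere. -/
def atSample [MeasurableSingletonClass X] [MeasurableSingletonClass Y] {t : ℕ}
    (B : Fin t → Measure (X × Y)) [∀ k, IsFiniteMeasure (B k)] (z : X × Y) : Perturbation B :=
  indicatorConstLp ∞ (measurableSet_singleton z) (measure_ne_top (bufferMeasure B) {z}) (1 : ℝ)

open Classical in
/-- The tolerance function `ε` with its value at the single sample `z` replaced by `r`. -/
def setAt (ε : X × Y → ℝ) (z : X × Y) (r : ℝ) : X × Y → ℝ :=
  Function.update ε z r

end SampleLevel

end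

open MeasureTheory Filter Topology
open scoped ENNReal

namespace SampleLevel

/-! The argument is Lagrangian duality for a convex problem under Slater's condition. Let `v` be the
optimal value at `ε`. The point `(0, v)` lies outside the open convex set `strictEpigraph`, so
Hahn–Banach separates them; strict feasibility makes the hyperplane non-vertical, and its normalized
slope is a nonnegative multiplier with dual value at least `v` (`exists_multiplier_le`). Hence every
optimal dual variable `Λ` has dual value at least `v`.

Weak duality at the perturbed tolerances (`optValue_sub_le`) then gives `v - Λ h` as a lower bound
for the value at `ε + h`, for all `h`. This affine minorant is exact at `h = 0`, so `-Λ` is a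
subgradient. The single-sample claims restrict the bound to multiples of the indicator of `{z}`. -/

theorem setAt_self {X Y : Type*} (ε : X × Y → ℝ) (z : X × Y) : setAt ε z (ε z) = ε := by
  simp [setAt]

variable {X Y E : Type*} [MeasurableSpace X] [MeasurableSpace Y] {t : ℕ}

theorem ae_bufferMeasure_iff {B : Fin t → Measure (X × Y)} {p : X × Y → Prop} :
    (∀ᵐ z ∂(bufferMeasure B), p z) ↔ ∀ k, ∀ᵐ z ∂(B k), p z := by
  simp [bufferMeasure, ae_finsetSum_measure_iff]

theorem mem_feasible_iff {F : Set (X → E)} {loss : E → Y → ℝ} {B : Fin t → Measure (X × Y)}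
    {e : X × Y → ℝ} {f : X → E} :
    f ∈ feasible F loss B e ↔ f ∈ F ∧ ∀ᵐ z ∂(bufferMeasure B), loss (f z.1) z.2 ≤ e z := by
  rw [ae_bufferMeasure_iff]; rfl

/-- Perturbations are classes of functions, so tolerances matter only up to null sets. -/
theorem optValue_congr {F : Set (X → E)} {loss : E → Y → ℝ} {D : Measure (X × Y)}
    {B : Fin t → Measure (X × Y)} {e e' : X × Y → ℝ} (h : e =ᵐ[bufferMeasure B] e') :
    optValue F loss D B e = optValue F loss D B e' := by
  have : feasible F loss B e = feasible F loss B e' := by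
    ext f
    simp only [mem_feasible_iff]
    refine and_congr_right fun _ => eventually_congr ?_
    filter_upwards [h] with z hz
    rw [hz]
  unfold optValue
  rw [this]

theorem ae_abs_le_norm {B : Fin t → Measure (X × Y)} (h : Perturbation B) :
    ∀ᵐ z ∂(bufferMeasure B), |h z| ≤ ‖h‖ := by
  filter_upwards [enorm_ae_le_eLpNormEssSup (h : X × Y → ℝ) (bufferMeasure B)] with z hz
  rw [Lp.norm_def, eLpNorm_exponent_top, ← Real.norm_eq_abs, ← toReal_enorm]
  refine ENNReal.toReal_mono ?_ hz
  rw [← eLpNorm_exponent_top]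
  exact Lp.eLpNorm_ne_top h

/-! ### The strict epigraph: convexity and openness -/

/-- The pairs of a perturbation and a value that some predictor of the class achieves strictly. -/
def strictEpigraph (F : Set (X → E)) (loss : E → Y → ℝ) (D : Measure (X × Y))
    (B : Fin t → Measure (X × Y)) (ε : X × Y → ℝ) : Set (Perturbation B × ℝ) :=
  {p | ∃ f ∈ F, ∃ δ : ℝ, 0 < δ ∧
    (∀ᵐ z ∂(bufferMeasure B), loss (f z.1) z.2 - ε z + δ ≤ p.1 z) ∧ risk loss D f < p.2}

theorem convexOn_risk {F : Set (X → E)} [AddCommGroup E] [Module ℝ E] {loss : E → Y → ℝ}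
    {D : Measure (X × Y)}
    (hint : ∀ f ∈ F, Integrable (fun z : X × Y => loss (f z.1) z.2) D) (hF : Convex ℝ F)
    (hloss : ∀ x y, ConvexOn ℝ F (fun f => loss (f x) y)) :
    ConvexOn ℝ F (risk loss D) := by
  refine ⟨hF, fun f hf g hg a b ha hb hab => ?_⟩
  have hi := ((hint f hf).const_mul a).add ((hint g hg).const_mul b)
  calc risk loss D (a • f + b • g)
      ≤ ∫ z, (a * loss (f z.1) z.2 + b * loss (g z.1) z.2) ∂D :=
        integral_mono (hint _ (hF hf hg ha hb hab)) hi
          fun z => (hloss z.1 z.2).2 hf hg ha hb hab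
    _ = a • risk loss D f + b • risk loss D g := by
        rw [integral_add ((hint f hf).const_mul a) ((hint g hg).const_mul b),
          integral_const_mul, integral_const_mul]
        rfl

theorem convex_strictEpigraph {F : Set (X → E)} [AddCommGroup E] [Module ℝ E]
    {loss : E → Y → ℝ} {D : Measure (X × Y)} {B : Fin t → Measure (X × Y)} {ε : X × Y → ℝ}
    (hint : ∀ f ∈ F, Integrable (fun z : X × Y => loss (f z.1) z.2) D) (hF : Convex ℝ F)
    (hloss : ∀ x y, ConvexOn ℝ F (fun f => loss (f x) y)) :
    Convex ℝ (strictEpigraph F loss D B ε) := by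
  rw [convex_iff_forall_pos]
  rintro ⟨h, r⟩ ⟨f, hf, δ, hδ, hfh, hfr⟩ ⟨h', r'⟩ ⟨g, hg, δ', hδ', hgh, hgr⟩ a b ha hb hab
  refine ⟨a • f + b • g, hF hf hg ha.le hb.le hab, a * δ + b * δ', by positivity, ?_, ?_⟩
  · filter_upwards [hfh, hgh, Lp.coeFn_add (a • h) (b • h'), Lp.coeFn_smul a h,
      Lp.coeFn_smul b h'] with z h1 h2 h3 h4 h5
    have hconv := (hloss z.1 z.2).2 hf hg ha.le hb.le hab
    simp only [Prod.smul_mk, Prod.mk_add_mk, h3, Pi.add_apply, h4, h5, Pi.smul_apply,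
      smul_eq_mul] at hconv h1 h2 ⊢
    have h6 := mul_le_mul_of_nonneg_left h1 ha.le
    have h7 := mul_le_mul_of_nonneg_left h2 hb.le
    have h8 : a * ε z + b * ε z = ε z := by rw [← add_mul, hab, one_mul]
    linarith
  · have hconv := (convexOn_risk hint hF hloss).2 hf hg ha.le hb.le hab
    simp only [Prod.smul_mk, Prod.mk_add_mk, smul_eq_mul] at hconv hfr hgr ⊢
    have h6 := mul_lt_mul_of_pos_left hfr ha
    have h7 := mul_lt_mul_of_pos_left hgr hb
    linarith

/-- The uniform margin `δ` gives openness: moving `h` by less than `δ / 2` in sup norm costs at most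
half of it. -/
theorem isOpen_strictEpigraph (F : Set (X → E)) (loss : E → Y → ℝ) (D : Measure (X × Y))
    (B : Fin t → Measure (X × Y)) (ε : X × Y → ℝ) :
    IsOpen (strictEpigraph F loss D B ε) := by
  rw [isOpen_iff_mem_nhds]
  rintro ⟨h, r⟩ ⟨f, hf, δ, hδ, hfh, hfr⟩
  have h1 : ∀ᶠ p : Perturbation B × ℝ in 𝓝 (h, r), p.1 ∈ Metric.ball h (δ / 2) :=
    continuous_fst.continuousAt.eventually_mem (Metric.ball_mem_nhds h (half_pos hδ))
  have h2 : ∀ᶠ p : Perturbation B × ℝ in 𝓝 (h, r), risk loss D f < p.2 :=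
    continuous_snd.continuousAt.eventually_mem (Ioi_mem_nhds hfr)
  filter_upwards [h1, h2] with p hp1 hp2
  refine ⟨f, hf, δ / 2, half_pos hδ, ?_, hp2⟩
  rw [mem_ball_iff_norm] at hp1
  filter_upwards [hfh, ae_abs_le_norm (p.1 - h), Lp.coeFn_sub p.1 h] with z hz hn hs
  rw [hs, Pi.sub_apply] at hn
  have := (abs_le.1 hn).1
  linarith

/-! ### Strong duality by separation -/

/-- Strong duality in terms of dominating perturbations: a nonnegative multiplier whose penalized
risk is at least any lower bound of the problem. -/
theorem exists_multiplier_le {F : Set (X → E)} [AddCommGroup E] [Module ℝ E]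
    {loss : E → Y → ℝ} {D : Measure (X × Y)} {B : Fin t → Measure (X × Y)}
    [∀ k, IsFiniteMeasure (B k)] {ε : X × Y → ℝ}
    (hint : ∀ f ∈ F, Integrable (fun z : X × Y => loss (f z.1) z.2) D) (hF : Convex ℝ F)
    (hloss : ∀ x y, ConvexOn ℝ F (fun f => loss (f x) y))
    (hstrict : ∃ f ∈ F, ∃ c : ℝ, 0 < c ∧
      ∀ k, ∀ᵐ z ∂(B k), loss (f z.1) z.2 ≤ ε z - c)
    {v : ℝ} (hv : ∀ f ∈ feasible F loss B ε, v ≤ risk loss D f) :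
    ∃ Λ : Multiplier B, Λ.IsNonneg ∧ ∀ f ∈ F, ∀ h : Perturbation B,
      (∀ᵐ z ∂(bufferMeasure B), loss (f z.1) z.2 - ε z ≤ h z) → v ≤ risk loss D f + Λ h := by
  have hnot : ((0 : Perturbation B), v) ∉ strictEpigraph F loss D B ε := by
    rintro ⟨f, hf, δ, hδ, hfh, hfr⟩
    refine (hv f (mem_feasible_iff.2 ⟨hf, ?_⟩)).not_gt hfr
    filter_upwards [hfh, Lp.coeFn_zero ℝ ∞ (bufferMeasure B)] with z hz h0
    rw [h0, Pi.zero_apply] at hz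
    linarith
  obtain ⟨φ, hφ⟩ := geometric_hahn_banach_open_point
    (convex_strictEpigraph hint hF hloss) (isOpen_strictEpigraph F loss D B ε) hnot
  set ξ : Multiplier B := φ.comp (ContinuousLinearMap.inl ℝ _ _)
  set α : ℝ := φ (0, 1)
  have hsplit : ∀ (h : Perturbation B) (r : ℝ), φ (h, r) = ξ h + r * α := by
    intro h r
    have : ((h, r) : Perturbation B × ℝ) = (h, 0) + r • ((0 : Perturbation B), (1 : ℝ)) := by
      simp
    rw [this, map_add, map_smul]
    rfl
  have hsep : ∀ p ∈ strictEpigraph F loss D B ε, ξ p.1 + p.2 * α < v * α := by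
    intro p hp
    have := hφ p hp
    rwa [hsplit, ← Prod.mk.eta (p := p), hsplit, map_zero, zero_add] at this
  obtain ⟨f₀, hf₀, c, hc, hfc⟩ := hstrict
  rw [← ae_bufferMeasure_iff] at hfc
  have hzero : ∀ h : Perturbation B, 0 ≤ h → ∀ r, risk loss D f₀ < r →
      (h, r) ∈ strictEpigraph F loss D B ε := by
    intro h hh r hr
    refine ⟨f₀, hf₀, c, hc, ?_, hr⟩
    filter_upwards [hfc, (Lp.coeFn_nonneg h).2 hh] with z hz h0
    simp only [Pi.zero_apply] at h0
    linarith
  -- Non-verticality: by strict feasibility the set contains a point `(0, r)` with `r > v`, where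
  -- separation reads `r * α < v * α`.
  have hαneg : α < 0 := by
    have h1 := hsep _ (hzero 0 le_rfl (max (risk loss D f₀) v + 1)
      ((le_max_left _ _).trans_lt (lt_add_one _)))
    have h2 := le_max_right (risk loss D f₀) v
    simp only [map_zero, zero_add] at h1
    by_contra! h3
    nlinarith
  -- Relaxing the constraints along `n • h` keeps `f₀` admissible, so `ξ` is bounded above on this
  -- ray.
  have hξnonpos : ∀ h : Perturbation B, 0 ≤ h → ξ h ≤ 0 := by
    intro h hh
    by_contra! hpos
    set r := risk loss D f₀ + 1
    have hsmul : ∀ n : ℕ, 0 ≤ (n : ℝ) • h := by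
      intro n
      refine (Lp.coeFn_nonneg _).1 ?_
      filter_upwards [Lp.coeFn_smul (n : ℝ) h, (Lp.coeFn_nonneg h).2 hh] with z h1 h2
      rw [h1]
      exact mul_nonneg n.cast_nonneg h2
    obtain ⟨n, hn⟩ := exists_nat_gt ((v * α - r * α) / ξ h)
    have h1 := hsep _ (hzero ((n : ℝ) • h) (hsmul n) r (lt_add_one _))
    rw [div_lt_iff₀ hpos] at hn
    simp only [map_smul, smul_eq_mul] at h1
    linarith
  refine ⟨α⁻¹ • ξ, fun h hh => ?_, fun f hf h hfh => ?_⟩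
  · exact mul_nonneg_of_nonpos_of_nonpos (inv_nonpos.2 hαneg.le) (hξnonpos h hh)
  · set w : Perturbation B := Lp.const ∞ (bufferMeasure B) (1 : ℝ) with hw
    -- The pair `(h, risk)` has no margin, so both entries are raised by `δ` to enter the open set;
    -- then `δ → 0`.
    have hmem : ∀ δ : ℝ, 0 < δ → v ≤ (risk loss D f + δ) + α⁻¹ * (ξ h + δ * ξ w) := by
      intro δ hδ
      have h1 := hsep (h + δ • w, risk loss D f + δ) ⟨f, hf, δ, hδ, by
        filter_upwards [hfh, Lp.coeFn_add h (δ • w), Lp.coeFn_smul δ w,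
          Lp.coeFn_const ∞ (bufferMeasure B) (1 : ℝ)] with z hz h1 h2 h3
        rw [h1, Pi.add_apply, h2, Pi.smul_apply, hw, h3, Function.const_apply, smul_eq_mul,
          mul_one]
        linarith, lt_add_of_pos_right _ hδ⟩
      simp only [map_add, map_smul, smul_eq_mul] at h1
      have h2 := mul_lt_mul_of_neg_left h1 (inv_lt_zero.2 hαneg)
      have h3 : α⁻¹ * α = 1 := inv_mul_cancel₀ hαneg.ne
      have h4 : α⁻¹ * (v * α) = v := by rw [mul_left_comm, h3, mul_one]
      have h5 : α⁻¹ * ((ξ h + δ * ξ w) + (risk loss D f + δ) * α)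
          = α⁻¹ * (ξ h + δ * ξ w) + (risk loss D f + δ) := by
        rw [mul_add, mul_left_comm _ (risk loss D f + δ), h3, mul_one]
      linarith
    have hlim : Tendsto (fun δ : ℝ => (risk loss D f + δ) + α⁻¹ * (ξ h + δ * ξ w)) (𝓝[>] 0)
        (𝓝 ((risk loss D f + 0) + α⁻¹ * (ξ h + 0 * ξ w))) :=
      Continuous.tendsto' (by fun_prop) _ _ rfl |>.mono_left nhdsWithin_le_nhds
    have := ge_of_tendsto hlim (eventually_mem_nhdsWithin.mono hmem)
    simpa using this

/-! ### Dual function, weak duality and the affine minorant -/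

theorem pairing_le {B : Fin t → Measure (X × Y)} {Λ : Multiplier B} {s : X × Y → ℝ}
    {h : Perturbation B} (hs : ∀ᵐ z ∂(bufferMeasure B), s z ≤ h z) :
    pairing Λ s ≤ (Λ h : EReal) :=
  iInf₂_le h hs

theorem le_dualFunction {F : Set (X → E)} {loss : E → Y → ℝ} {D : Measure (X × Y)}
    {B : Fin t → Measure (X × Y)} {ε : X × Y → ℝ} {Λ : Multiplier B} {v : ℝ}
    (hΛ : ∀ f ∈ F, ∀ h : Perturbation B,
      (∀ᵐ z ∂(bufferMeasure B), loss (f z.1) z.2 - ε z ≤ h z) → v ≤ risk loss D f + Λ h) :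
    (v : EReal) ≤ dualFunction F loss D ε Λ := by
  refine le_iInf₂ fun f hf => ?_
  have : ((v - risk loss D f : ℝ) : EReal) ≤ pairing Λ (fun z => loss (f z.1) z.2 - ε z) :=
    le_iInf₂ fun h hh => EReal.coe_le_coe_iff.2 (by linarith [hΛ f hf h hh])
  calc (v : EReal) = (risk loss D f : EReal) + ((v - risk loss D f : ℝ) : EReal) := by
        rw [← EReal.coe_add, add_sub_cancel]
    _ ≤ _ := add_le_add_right this _

/-- The dual function bounds the Lagrangian penalty of every predictor that is feasible for the
perturbed tolerances. -/
theorem dualFunction_le {F : Set (X → E)} {loss : E → Y → ℝ} {D : Measure (X × Y)}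
    {B : Fin t → Measure (X × Y)} {ε : X × Y → ℝ} (Λ : Multiplier B) (h : Perturbation B)
    {f : X → E} (hf : f ∈ feasible F loss B (fun z => ε z + h z)) :
    dualFunction F loss D ε Λ ≤ ((risk loss D f + Λ h : ℝ) : EReal) := by
  rw [mem_feasible_iff] at hf
  refine (iInf₂_le f hf.1).trans ?_
  rw [EReal.coe_add]
  exact add_le_add_right (pairing_le (hf.2.mono fun z hz => by linarith)) _

theorem optValue_add_zero {F : Set (X → E)} {loss : E → Y → ℝ} {D : Measure (X × Y)}
    {B : Fin t → Measure (X × Y)} {ε : X × Y → ℝ} :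
    optValue F loss D B (fun z => ε z + (0 : Perturbation B) z) = optValue F loss D B ε := by
  refine optValue_congr ?_
  filter_upwards [Lp.coeFn_zero ℝ ∞ (bufferMeasure B)] with z hz
  rw [hz, Pi.zero_apply, add_zero]

theorem dualFunction_le_optValue {F : Set (X → E)} {loss : E → Y → ℝ} {D : Measure (X × Y)}
    {B : Fin t → Measure (X × Y)} {ε : X × Y → ℝ} (Λ : Multiplier B) :
    dualFunction F loss D ε Λ ≤ optValue F loss D B ε := by
  rw [← optValue_add_zero]
  exact le_iInf₂ fun f hf => by simpa using dualFunction_le Λ 0 hf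

/-- Weak duality at `ε + h`: a predictor feasible there has residual at most `h`, so its penalty is
at most `Λ h`. -/
theorem optValue_sub_le {F : Set (X → E)} {loss : E → Y → ℝ} {D : Measure (X × Y)}
    {B : Fin t → Measure (X × Y)} {ε : X × Y → ℝ} {Λ : Multiplier B} {v : ℝ}
    (hv : (v : EReal) ≤ dualFunction F loss D ε Λ) (h : Perturbation B) :
    ((v - Λ h : ℝ) : EReal) ≤ optValue F loss D B (fun z => ε z + h z) :=
  le_iInf₂ fun f hf => EReal.coe_le_coe_iff.2 (by
    linarith [EReal.coe_le_coe_iff.1 (hv.trans (dualFunction_le Λ h hf))])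

/-! ### Perturbing a single sample -/

variable [MeasurableSingletonClass X] [MeasurableSingletonClass Y]

theorem coeFn_atSample (B : Fin t → Measure (X × Y)) [∀ k, IsFiniteMeasure (B k)] (z : X × Y) :
    atSample B z =ᵐ[bufferMeasure B] ({z} : Set (X × Y)).indicator fun _ => (1 : ℝ) :=
  indicatorConstLp_coeFn

theorem setAt_ae_eq (B : Fin t → Measure (X × Y)) [∀ k, IsFiniteMeasure (B k)]
    (ε : X × Y → ℝ) (z : X × Y) (r : ℝ) :
    setAt ε z r =ᵐ[bufferMeasure B] fun x => ε x + ((r - ε z) • atSample B z) x := by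
  filter_upwards [Lp.coeFn_smul (r - ε z) (atSample B z),
    coeFn_atSample B z] with x h1 h2
  rw [h1, Pi.smul_apply, h2]
  by_cases hx : x = z
  · subst hx
    simp [setAt]
  · simp [setAt, hx]

theorem HasDensity.apply_atSample {B : Fin t → Measure (X × Y)} [∀ k, IsFiniteMeasure (B k)]
    {Λ : Multiplier B} {w : X × Y → ℝ} (hw : HasDensity Λ w) (z : X × Y) :
    Λ (atSample B z) = (bufferMeasure B).real {z} * w z := by
  rw [hw.2]
  calc ∫ x, w x * atSample B z x ∂(bufferMeasure B)
      = ∫ x, ({z} : Set (X × Y)).indicator w x ∂(bufferMeasure B) := by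
        refine integral_congr_ae ?_
        filter_upwards [coeFn_atSample B z] with x hx
        rw [hx]
        by_cases h : x = z <;> simp [h]
    _ = (bufferMeasure B).real {z} * w z := by
        rw [integral_indicator (measurableSet_singleton z), integral_singleton, smul_eq_mul]

end SampleLevel

/-- A global affine minorant that is exact at a point is a Fréchet subgradient there. -/
theorem mem_frechetSubdiff_of_forall_le {V : Type*} [NormedAddCommGroup V] [NormedSpace ℝ V]
    {φ : V → EReal} {x : V} {ξ : V →L[ℝ] ℝ} {v : ℝ} (hx : φ x = v)
    (h : ∀ y, ((v + ξ (y - x) : ℝ) : EReal) ≤ φ y) : ξ ∈ frechetSubdiff φ x := by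
  refine ⟨by simp [hx], by simp [hx], fun η hη => Eventually.of_forall fun y => ?_⟩
  refine le_trans ?_ (h y)
  rw [hx, ← EReal.coe_add, EReal.coe_le_coe_iff]
  have := mul_nonneg hη.le (norm_nonneg (y - x))
  linarith

theorem proposition3 {X Y E : Type*} [MeasurableSpace X] [MeasurableSpace Y]
    [MeasurableSingletonClass X] [MeasurableSingletonClass Y]
    [AddCommGroup E] [Module ℝ E] {t : ℕ}
    (F : Set (X → E)) (loss : E → Y → ℝ)
    (D : Measure (X × Y)) [IsProbabilityMeasure D]
    (B : Fin t → Measure (X × Y)) [∀ k, IsProbabilityMeasure (B k)]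
    (ε : X × Y → ℝ)
    -- the expected loss is well defined on the class, and the problem is bounded below
    (hint : ∀ f ∈ F, Integrable (fun z : X × Y => loss (f z.1) z.2) D)
    (hbdd : SampleLevel.optValue F loss D B ε ≠ ⊥)
    -- convexity of the class, and of the loss as a function of the predictor
    (hF : Convex ℝ F)
    (hloss : ∀ x y, ConvexOn ℝ F (fun f => loss (f x) y))
    -- strict feasibility: some predictor satisfies all the constraints with a margin
    (hstrict : ∃ f ∈ F, ∃ c : ℝ, 0 < c ∧
      ∀ k, ∀ᵐ z ∂(B k), loss (f z.1) z.2 ≤ ε z - c) :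
    -- optimal dual variables exist
    (∃ Λ : SampleLevel.Multiplier B, SampleLevel.IsOptimalDual F loss D ε Λ) ∧
    ∀ Λ : SampleLevel.Multiplier B, SampleLevel.IsOptimalDual F loss D ε Λ →
      -- sensitivity to perturbations of the whole tolerance function
      -Λ ∈ frechetSubdiff
        (fun h : SampleLevel.Perturbation B =>
          SampleLevel.optValue F loss D B (fun z => ε z + h z)) 0 ∧
      -- sensitivity to the tolerance at each single sample
      (∀ z : X × Y,
        (-(Λ (SampleLevel.atSample B z))) • ContinuousLinearMap.id ℝ ℝ ∈ frechetSubdiff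
          (fun r : ℝ => SampleLevel.optValue F loss D B (SampleLevel.setAt ε z r)) (ε z)) ∧
      -- the same for a dual variable function, per unit of buffer mass of the sample
      (∀ w : X × Y → ℝ, SampleLevel.HasDensity Λ w →
        ∀ z : X × Y, SampleLevel.bufferMeasure B {z} ≠ 0 →
          (-(w z)) • ContinuousLinearMap.id ℝ ℝ ∈ frechetSubdiff
            (fun s : ℝ => SampleLevel.optValue F loss D B
              (SampleLevel.setAt ε z (ε z + s / (SampleLevel.bufferMeasure B).real {z}))) 0) := by
  have htop : SampleLevel.optValue F loss D B ε ≠ ⊤ := by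
    obtain ⟨f, hf, c, hc, hfc⟩ := hstrict
    refine ne_top_of_le_ne_top (EReal.coe_ne_top (SampleLevel.risk loss D f)) (iInf₂_le f ⟨hf, ?_⟩)
    exact fun k => (hfc k).mono fun z hz => by linarith
  obtain ⟨v, hv⟩ : ∃ v : ℝ, SampleLevel.optValue F loss D B ε = v :=
    ⟨_, (EReal.coe_toReal htop hbdd).symm⟩
  obtain ⟨Λ₀, hΛ₀, hΛ₀v⟩ := SampleLevel.exists_multiplier_le hint hF hloss hstrict
    (v := v) (fun f hf => EReal.coe_le_coe_iff.1 (hv ▸ iInf₂_le f hf))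
  have hdual := SampleLevel.le_dualFunction hΛ₀v
  refine ⟨⟨Λ₀, hΛ₀, fun Λ' _ =>
    (SampleLevel.dualFunction_le_optValue Λ').trans (hv.le.trans hdual)⟩, fun Λ hΛ => ?_⟩
  -- Maximality of `Λ` against `Λ₀` passes the bound `v` on to `Λ`.
  have hsub := SampleLevel.optValue_sub_le (hdual.trans (hΛ.2 Λ₀ hΛ₀))
  have hset : ∀ (z : X × Y) (r : ℝ), ((v + -(Λ (SampleLevel.atSample B z)) * (r - ε z) : ℝ) : EReal)
      ≤ SampleLevel.optValue F loss D B (SampleLevel.setAt ε z r) := by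
    intro z r
    rw [SampleLevel.optValue_congr (SampleLevel.setAt_ae_eq B ε z r)]
    refine le_trans (le_of_eq ?_) (hsub _)
    rw [map_smul, smul_eq_mul]
    ring_nf
  refine ⟨?_, fun z => ?_, fun w hw z hz => ?_⟩
  · refine mem_frechetSubdiff_of_forall_le (SampleLevel.optValue_add_zero.trans hv) fun h => ?_
    simpa [sub_eq_add_neg] using hsub h
  · refine mem_frechetSubdiff_of_forall_le (v := v) (by rw [SampleLevel.setAt_self, hv]) fun r => ?_
    simpa using hset z r
  · refine mem_frechetSubdiff_of_forall_le (v := v) (by rw [zero_div, add_zero, SampleLevel.setAt_self, hv])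
      fun s => ?_
    have hm : (SampleLevel.bufferMeasure B).real {z} ≠ 0 :=
      (measureReal_ne_zero_iff (measure_ne_top _ _)).2 hz
    refine le_trans (le_of_eq ?_) (hset z _)
    -- `Λ` of the indicator is the mass times `w z`, and the mass cancels against `s / m`.
    rw [hw.apply_atSample]
    congr 1
    simp only [smul_apply, ContinuousLinearMap.id_apply, smul_eq_mul]
    field_simp
    ring
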